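/- Let $\mathcal H$ be a separable complex Hilbert space. A state $\rho$ (density operator, i.e. a positive operator of trace one) on $\mathcal H\otimes\mathcal H$ is said to be of the Bell class if there is a density operator $T$ on $\mathcal H\otimes\mathcal H\otimes\mathcal H$ whose three partial traces, over the first, the second and the third factor, are all equal to $\rho$: $$\mathrm{tr}^{(1)}_{\mathcal H}[T]=\mathrm{tr}^{(2)}_{\mathcal H}[T]=\mathrm{tr}^{(3)}_{\mathcal H}[T]=\rho .$$ Let $\Lambda_1,\Lambda_2\subseteq[-1,1]$ be outcome sets, let $M_1^{(a)}, M_1^{(b_1)}$ be normalized positive operator-valued (POV) measures on $\Lambda_1$ (Alice) and $M_2^{(b_1)}, M_2^{(b_2)}$ normalized POV measures on $\Lambda_2$ (Bob), all with values in the bounded operators on $\mathcal H$. For each of the settings $(s,t)=(a,b_1),(a,b_2),(b_1,b_2)$, let the joint measurement of Alice and Bob be described by the POV measure $M^{(s,t)}$ on $\Lambda_1\times\Lambda_2$ with $$M^{(s,t)}(B_1\times B_2)=M_1^{(s)}(B_1)\otimes M_2^{(t)}(B_2)$$ for all measurable $B_1\subseteq\Lambda_1$, $B_2\subseteq\Lambda_2$,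 and let $$\langle\lambda_1\lambda_2\rangle_\rho^{(s,t)}=\int_{\Lambda_1\times\Lambda_2}\lambda_1\lambda_2\,\mathrm{tr}\big[\rho\,M^{(s,t)}(d\lambda_1\times d\lambda_2)\big]$$ be the expectation value of the product of the outcomes in a state $\rho$. Suppose that $$\int_{\Lambda_1}\lambda_1\,M_1^{(b_1)}(d\lambda_1)=\int_{\Lambda_2}\lambda_2\,M_2^{(b_1)}(d\lambda_2).$$ Then, for every Bell class state $\rho$ on $\mathcal H\otimes\mathcal H$, $$\left|\langle\lambda_1\lambda_2\rangle_\rho^{(a,b_1)}-\langle\lambda_1\lambda_2\rangle_\rho^{(a,b_2)}\right|\le 1-\langle\lambda_1\lambda_2\rangle_\rho^{(b_1,b_2)} .$$ -/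

import Mathlib

open MeasureTheory TensorProduct UniformSpace
open scoped ENNReal

noncomputable section

namespace BellClass

/-! ### Hilbert tensor products -/

/-- The Hilbert space tensor product: the completion of the algebraic tensor product with respect
to the inner product determined by `⟪x ⊗ y, x' ⊗ y'⟫ = ⟪x, x'⟫ ⟪y, y'⟫`. -/
abbrev HTensor (E F : Type*) [NormedAddCommGroup E] [InnerProductSpace ℂ E]
    [NormedAddCommGroup F] [InnerProductSpace ℂ F] : Type _ :=
  Completion (E ⊗[ℂ] F)

section Tensor

variable {E F : Type*} [NormedAddCommGroup E] [InnerProductSpace ℂ E]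
  [NormedAddCommGroup F] [InnerProductSpace ℂ F]

/-- The elementary tensor `x ⊗ y` in the Hilbert tensor product. -/
def pureTensor (x : E) (y : F) : HTensor E F := ((x ⊗ₜ[ℂ] y : E ⊗[ℂ] F) : Completion (E ⊗[ℂ] F))

/-- The bounded operator `A ⊗ B`, the continuous extension of `x ⊗ y ↦ A x ⊗ B y`. -/
def tensorOp (A : E →L[ℂ] E) (B : F →L[ℂ] F) : HTensor E F →L[ℂ] HTensor E F :=
  (TensorProduct.mapL A B).completion

theorem tensorOp_pureTensor (A : E →L[ℂ] E) (B : F →L[ℂ] F) (x : E) (y : F) :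
    tensorOp A B (pureTensor x y) = pureTensor (A x) (B y) := by
  simp [tensorOp, pureTensor]

end Tensor

/-! ### Trace and density operators -/

section Trace

variable (K : Type*) [NormedAddCommGroup K] [InnerProductSpace ℂ K] [CompleteSpace K]

/-- The index set of a fixed orthonormal Hilbert basis of `K`. -/
def basisIndex : Set K := (exists_hilbertBasis ℂ K).choose

/-- A fixed orthonormal Hilbert basis of `K`. -/
def stdBasis : HilbertBasis (basisIndex K) ℂ K := (exists_hilbertBasis ℂ K).choose_spec.choose

variable {K}

/-- The trace `∑ i, ⟪e i, A (e i)⟫` (for a trace class operator, the sum converges and does not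
depend on the orthonormal basis). -/
def trace (A : K →L[ℂ] K) : ℂ := ∑' i, inner ℂ (stdBasis K i) (A (stdBasis K i))

variable (K) in
/-- A density operator (normal state): a positive trace class operator of trace one. -/
structure DensityOperator where
  op : K →L[ℂ] K
  pos : op.IsPositive
  hasSum_trace : HasSum (fun i => inner ℂ (stdBasis K i) (op (stdBasis K i))) 1

end Trace

/-! ### POV measures -/

/-- A (normalized) positive operator-valued measure on `Ω` with values in the bounded operators on
`K`; countable additivity is in the weak sense. Values on non-measurable sets are irrelevant. -/
structure POVM (Ω : Type*) [MeasurableSpace Ω] (K : Type*) [NormedAddCommGroup K]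
    [InnerProductSpace ℂ K] where
  effect : Set Ω → (K →L[ℂ] K)
  pos : ∀ B, MeasurableSet B → (effect B).IsPositive
  univ : effect Set.univ = 1
  iUnion : ∀ B : ℕ → Set Ω, (∀ n, MeasurableSet (B n)) → Pairwise (Function.onFun Disjoint B) →
    ∀ ψ : K, HasSum (fun n => inner ℂ ψ (effect (B n) ψ)) (inner ℂ ψ (effect (⋃ n, B n) ψ))

namespace POVM

variable {Ω : Type*} [MeasurableSpace Ω] {K : Type*} [NormedAddCommGroup K]
  [InnerProductSpace ℂ K]

theorem inner_empty (M : POVM Ω K) (ψ : K) : inner ℂ ψ (M.effect ∅ ψ) = 0 := by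
  have h := M.iUnion (fun _ => ∅) (fun _ => MeasurableSet.empty)
    (fun _ _ _ => by simp [Function.onFun]) ψ
  exact (summable_const_iff _).mp h.summable

theorem re_inner_nonneg (M : POVM Ω K) {B : Set Ω} (hB : MeasurableSet B) (ψ : K) :
    0 ≤ (inner ℂ ψ (M.effect B ψ)).re :=
  (M.pos B hB).re_inner_nonneg_right ψ

/-- The scalar measure `B ↦ ⟪ψ, M(B) ψ⟫`. -/
def vectorLaw (M : POVM Ω K) (ψ : K) : Measure Ω :=
  Measure.ofMeasurable (fun B _ => ENNReal.ofReal (inner ℂ ψ (M.effect B ψ)).re)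
    (by simp [M.inner_empty ψ])
    (by
      intro B hB hd
      have h := Complex.hasSum_re (M.iUnion B hB hd ψ)
      rw [← h.tsum_eq]
      exact ENNReal.ofReal_tsum_of_nonneg (fun n => M.re_inner_nonneg (hB n) ψ) h.summable)

theorem vectorLaw_apply (M : POVM Ω K) (ψ : K) {B : Set Ω} (hB : MeasurableSet B) :
    M.vectorLaw ψ B = ENNReal.ofReal (inner ℂ ψ (M.effect B ψ)).re :=
  Measure.ofMeasurable_apply B hB

/-- `W = ∫ λ M(dλ)` for a POV measure `M` on a set `Λ` of real outcomes, as a weak integral: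
`⟪ψ, W ψ⟫ = ∫ λ ⟪ψ, M(dλ) ψ⟫` for every `ψ`. -/
def IsAverage {Λ : Set ℝ} (M : POVM Λ K) (W : K →L[ℂ] K) : Prop :=
  ∀ ψ : K, inner ℂ ψ (W ψ) = ((∫ x, (x : ℝ) ∂(M.vectorLaw ψ) : ℝ) : ℂ)

end POVM

/-! ### The law of the outcomes of a POV measure in a state -/

section Law

theorem summable_mul_of_sq {ι : Type*} (f g : ι → ℂ) (hf : Summable fun i => ‖f i‖ ^ 2)
    (hg : Summable fun i => ‖g i‖ ^ 2) : Summable fun i => f i * g i := by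
  refine Summable.of_norm_bounded (hf.add hg) (fun i => ?_)
  rw [norm_mul]
  nlinarith [sq_nonneg (‖f i‖ - ‖g i‖), mul_nonneg (norm_nonneg (f i)) (norm_nonneg (g i))]

variable {K : Type*} [NormedAddCommGroup K] [InnerProductSpace ℂ K]

theorem hasSum_norm_inner_sq {ι : Type*} (b : HilbertBasis ι ℂ K) (x : K) :
    HasSum (fun i => ‖inner ℂ x (b i)‖ ^ 2) (‖x‖ ^ 2) := by
  have h := Complex.hasSum_re (b.hasSum_inner_mul_inner x x)
  have h1 : ∀ i, (inner ℂ x (b i) * inner ℂ (b i) x).re = ‖inner ℂ x (b i)‖ ^ 2 := by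
    intro i
    rw [← inner_conj_symm (b i) x, Complex.mul_conj, Complex.ofReal_re, Complex.normSq_eq_norm_sq]
  have h2 : (inner ℂ x x).re = ‖x‖ ^ 2 := inner_self_eq_norm_sq (𝕜 := ℂ) x
  rw [h2] at h
  exact h.congr_fun fun i => (h1 i).symm

theorem summable_norm_inner_sq {ι : Type*} (b : HilbertBasis ι ℂ K) (v : ι → K)
    (hv : Summable fun i => ‖v i‖ ^ 2) :
    Summable fun p : ι × ι => ‖inner ℂ (v p.1) (b p.2)‖ ^ 2 := by
  rw [summable_prod_of_nonneg (fun _ => by positivity)]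
  refine ⟨fun i => (hasSum_norm_inner_sq b (v i)).summable, ?_⟩
  refine hv.congr fun i => ?_
  exact ((hasSum_norm_inner_sq b (v i)).tsum_eq).symm

variable [CompleteSpace K]

/-- If `s` is a self-adjoint Hilbert-Schmidt operator then `tr (s² A) = tr (s A s)`. -/
theorem tsum_sq_mul {ι : Type*} (b : HilbertBasis ι ℂ K) (s A : K →L[ℂ] K)
    (hs : ∀ x y, inner ℂ (s x) y = inner ℂ x (s y)) (hsum : Summable fun i => ‖s (b i)‖ ^ 2) :
    ∑' i, inner ℂ (b i) (s (s (A (b i)))) = ∑' i, inner ℂ (s (b i)) (A (s (b i))) := by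
  have h1 := summable_norm_inner_sq b (fun i => s (b i)) hsum
  have h2 : Summable fun p : ι × ι => ‖inner ℂ (A.adjoint (s (b p.2))) (b p.1)‖ ^ 2 := by
    refine (Equiv.prodComm ι ι).summable_iff.mpr
      (summable_norm_inner_sq b (fun i => A.adjoint (s (b i))) ?_)
    refine Summable.of_nonneg_of_le (fun _ => by positivity) (fun i => ?_)
      (hsum.mul_left (‖A.adjoint‖ ^ 2))
    rw [← mul_pow]
    exact pow_le_pow_left₀ (norm_nonneg _) (A.adjoint.le_opNorm _) 2
  have h3 := summable_mul_of_sq _ _ h1 h2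
  have hrow : ∀ i, HasSum (fun j =>
      inner ℂ (s (b i)) (b j) * inner ℂ (A.adjoint (s (b j))) (b i))
      (inner ℂ (b i) (s (s (A (b i))))) := by
    intro i
    have h := b.hasSum_inner_mul_inner (s (b i)) (s (A (b i)))
    rw [hs (b i)] at h
    refine h.congr_fun fun j => ?_
    rw [ContinuousLinearMap.adjoint_inner_left, hs (b j)]
  have hcol : ∀ j, HasSum (fun i =>
      inner ℂ (s (b i)) (b j) * inner ℂ (A.adjoint (s (b j))) (b i))
      (inner ℂ (s (b j)) (A (s (b j)))) := by
    intro j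
    have h := b.hasSum_inner_mul_inner (A.adjoint (s (b j))) (s (b j))
    rw [ContinuousLinearMap.adjoint_inner_left] at h
    refine h.congr_fun fun i => ?_
    rw [hs (b i), mul_comm]
  have hrows := h3.hasSum.prod_fiberwise hrow
  have hcols := ((Equiv.prodComm ι ι).hasSum_iff.mpr h3.hasSum).prod_fiberwise hcol
  rw [hrows.tsum_eq, hcols.tsum_eq]

/-- `tr (ρ A)` as a sum of expectations of `A` in (unnormalized) vectors. -/
theorem exists_vectors (ρ : DensityOperator K) :
    ∃ v : basisIndex K → K, ∀ A : K →L[ℂ] K, A.IsPositive →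
      ENNReal.ofReal (trace (ρ.op * A)).re =
        ∑' i, ENNReal.ofReal (inner ℂ (v i) (A (v i))).re := by
  set b := stdBasis K with hb
  obtain ⟨s, hsa, hsq⟩ : ∃ s : K →L[ℂ] K, IsSelfAdjoint s ∧ s * s = ρ.op := by
    have h0 : 0 ≤ ρ.op := (ContinuousLinearMap.nonneg_iff_isPositive _).mpr ρ.pos
    exact ⟨CFC.sqrt ρ.op, (CFC.sqrt_nonneg ρ.op).isSelfAdjoint, CFC.sqrt_mul_sqrt_self ρ.op h0⟩
  have hs : ∀ x y, inner ℂ (s x) y = inner ℂ x (s y) := fun x y => hsa.isSymmetric x y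
  have hρ : ∀ x, ρ.op x = s (s x) := fun x => by rw [← hsq]; rfl
  have hsum : Summable fun i => ‖s (b i)‖ ^ 2 := by
    refine (Complex.hasSum_re ρ.hasSum_trace).summable.congr fun i => ?_
    rw [hρ, ← hs]
    exact inner_self_eq_norm_sq (𝕜 := ℂ) (s (b i))
  refine ⟨fun i => s (b i), fun A hA => ?_⟩
  have htr : trace (ρ.op * A) = ∑' i, inner ℂ (s (b i)) (A (s (b i))) := by
    rw [← tsum_sq_mul b s A hs hsum]
    exact tsum_congr fun i => by rw [mul_apply_eq_comp, hρ]
  have hS : Summable fun i => inner ℂ (s (b i)) (A (s (b i))) := by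
    refine Summable.of_norm_bounded (hsum.mul_left ‖A‖) fun i => ?_
    refine (norm_inner_le_norm _ _).trans ?_
    have := A.le_opNorm (s (b i))
    nlinarith [norm_nonneg (s (b i))]
  rw [htr, ← (Complex.hasSum_re hS.hasSum).tsum_eq]
  exact ENNReal.ofReal_tsum_of_nonneg (fun i => hA.re_inner_nonneg_right _)
    (Complex.hasSum_re hS.hasSum).summable

theorem ofReal_trace_iUnion {Ω : Type*} [MeasurableSpace Ω] (ρ : DensityOperator K)
    (M : POVM Ω K) (B : ℕ → Set Ω) (hB : ∀ n, MeasurableSet (B n))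
    (hd : Pairwise (Function.onFun Disjoint B)) :
    ENNReal.ofReal (trace (ρ.op * M.effect (⋃ n, B n))).re =
      ∑' n, ENNReal.ofReal (trace (ρ.op * M.effect (B n))).re := by
  obtain ⟨v, hv⟩ := exists_vectors ρ
  have key : ∀ C, MeasurableSet C → ENNReal.ofReal (trace (ρ.op * M.effect C)).re =
      Measure.sum (fun i => M.vectorLaw (v i)) C := by
    intro C hC
    rw [hv _ (M.pos C hC), Measure.sum_apply _ hC]
    exact tsum_congr fun i => (M.vectorLaw_apply (v i) hC).symm
  rw [key _ (MeasurableSet.iUnion hB), measure_iUnion hd hB]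
  exact tsum_congr fun n => (key _ (hB n)).symm

theorem ofReal_trace_empty {Ω : Type*} [MeasurableSpace Ω] (ρ : DensityOperator K)
    (M : POVM Ω K) : ENNReal.ofReal (trace (ρ.op * M.effect ∅)).re = 0 := by
  obtain ⟨v, hv⟩ := exists_vectors ρ
  rw [hv _ (M.pos ∅ MeasurableSet.empty)]
  simp [M.inner_empty]

/-- The probability law `B ↦ tr (ρ M(B))` of the outcomes of the measurement `M` in the
state `ρ`. -/
def outcomeLaw {Ω : Type*} [MeasurableSpace Ω] (ρ : DensityOperator K) (M : POVM Ω K) :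
    Measure Ω :=
  Measure.ofMeasurable (fun B _ => ENNReal.ofReal (trace (ρ.op * M.effect B)).re)
    (ofReal_trace_empty ρ M) (fun B hB hd => ofReal_trace_iUnion ρ M B hB hd)

end Law

/-! ### Joint measurements of Alice and Bob -/

section Joint

variable {H₁ H₂ : Type*} [NormedAddCommGroup H₁] [InnerProductSpace ℂ H₁]
  [NormedAddCommGroup H₂] [InnerProductSpace ℂ H₂]

/-- `M` is the POV measure of the joint measurement in which Alice measures `M₁` and Bob
measures `M₂`: `M (B₁ × B₂) = M₁ (B₁) ⊗ M₂ (B₂)`. -/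
def IsJoint {Ω₁ Ω₂ : Type*} [MeasurableSpace Ω₁] [MeasurableSpace Ω₂] (M₁ : POVM Ω₁ H₁)
    (M₂ : POVM Ω₂ H₂) (M : POVM (Ω₁ × Ω₂) (HTensor H₁ H₂)) : Prop :=
  ∀ B₁ B₂, MeasurableSet B₁ → MeasurableSet B₂ →
    M.effect (B₁ ×ˢ B₂) = tensorOp (M₁.effect B₁) (M₂.effect B₂)

/-- The expectation `∫ λ₁ λ₂ tr (ρ M(dλ₁ × dλ₂))` of the product of the outcomes. -/
def productExpectation {Λ₁ Λ₂ : Set ℝ} (ρ : DensityOperator (HTensor H₁ H₂))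
    (M : POVM (Λ₁ × Λ₂) (HTensor H₁ H₂)) : ℝ :=
  ∫ x, (x.1 : ℝ) * (x.2 : ℝ) ∂(outcomeLaw ρ M)

end Joint

/-! ### Partial traces and Bell class states -/

section Bell

variable {H : Type*} [NormedAddCommGroup H] [InnerProductSpace ℂ H] [CompleteSpace H]

/-- The elementary tensor `x ⊗ y ⊗ z` in `H ⊗ H ⊗ H`. -/
def pureTensor₃ (x y z : H) : HTensor (HTensor H H) H := pureTensor (pureTensor x y) z

/-- `R` is the partial trace of the trace class operator `T` over the first factor. -/
def IsPartialTrace₁ (T : HTensor (HTensor H H) H →L[ℂ] HTensor (HTensor H H) H)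
    (R : HTensor H H →L[ℂ] HTensor H H) : Prop :=
  ∀ x y x' y' : H, HasSum
    (fun i => inner ℂ (pureTensor₃ (stdBasis H i) x y) (T (pureTensor₃ (stdBasis H i) x' y')))
    (inner ℂ (pureTensor x y) (R (pureTensor x' y')))

/-- `R` is the partial trace of the trace class operator `T` over the second factor. -/
def IsPartialTrace₂ (T : HTensor (HTensor H H) H →L[ℂ] HTensor (HTensor H H) H)
    (R : HTensor H H →L[ℂ] HTensor H H) : Prop :=
  ∀ x y x' y' : H, HasSum
    (fun i => inner ℂ (pureTensor₃ x (stdBasis H i) y) (T (pureTensor₃ x' (stdBasis H i) y')))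
    (inner ℂ (pureTensor x y) (R (pureTensor x' y')))

/-- `R` is the partial trace of the trace class operator `T` over the third factor. -/
def IsPartialTrace₃ (T : HTensor (HTensor H H) H →L[ℂ] HTensor (HTensor H H) H)
    (R : HTensor H H →L[ℂ] HTensor H H) : Prop :=
  ∀ x y x' y' : H, HasSum
    (fun i => inner ℂ (pureTensor₃ x y (stdBasis H i)) (T (pureTensor₃ x' y' (stdBasis H i))))
    (inner ℂ (pureTensor x y) (R (pureTensor x' y')))

/-- A state on `H ⊗ H` is of the Bell class if it has a density source-operator on `H ⊗ H ⊗ H` all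
three partial traces of which are equal to the state. -/
def IsBellClass (ρ : DensityOperator (HTensor H H)) : Prop :=
  ∃ T : DensityOperator (HTensor (HTensor H H) H),
    IsPartialTrace₁ T.op ρ.op ∧ IsPartialTrace₂ T.op ρ.op ∧ IsPartialTrace₃ T.op ρ.op

end Bell

end BellClass

end

/-! Let A, W, B stand for the averages of the settings a, b₁, b₂; each lies between -1 and 1 in the
operator order. The hypothesis makes W the same operator whether Alice or Bob measures b₁. If `T` is
a source operator of ρ, its partial traces over the third, second and first factor turn tr ρ(A ⊗ W),
tr ρ(A ⊗ B), tr ρ(W ⊗ B) into tr T(A ⊗ W ⊗ 1), tr T(A ⊗ 1 ⊗ B), tr T(1 ⊗ W ⊗ B)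
(`IsPartialTrace₁.traceL_eq` and its analogues). So all three correlations live in one state.

There the inequality is algebra: Re tr T(X ⊗ Y ⊗ Z) is nonnegative on positive X, Y, Z, and
expanding it at suitable 1 ± A, 1 ± W, 1 ± B gives the bound (`abs_sub_le_of_trilinear`). No joint
law of the three outcomes is needed.

Only W is given as an operator. The other averages are replaced by finite sums with outcomes rounded
to multiples of 1/n (`POVM.roundedAverage`). The errors are O(1/n) by
`abs_productExpectation_sub_le` and `abs_traceL_tensorOp_le`, and vanish as n → ∞. -/

namespace BellClass

universe u

/-! ### Traces against a density operator, in an arbitrary Hilbert basis. -/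

section Trace

variable {K : Type u} [NormedAddCommGroup K] [InnerProductSpace ℂ K]

theorem summable_norm_inner_sq_of_basis {ι κ : Type*} (b : HilbertBasis ι ℂ K) (v : κ → K)
    (hv : Summable fun j => ‖v j‖ ^ 2) :
    Summable fun p : κ × ι => ‖inner ℂ (v p.1) (b p.2)‖ ^ 2 := by
  rw [summable_prod_of_nonneg (fun _ => by positivity)]
  exact ⟨fun j => (hasSum_norm_inner_sq b (v j)).summable,
    hv.congr fun j => ((hasSum_norm_inner_sq b (v j)).tsum_eq).symm⟩

theorem summable_inner_apply {κ : Type*} {v : κ → K} (hv : Summable fun j => ‖v j‖ ^ 2)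
    (A : K →L[ℂ] K) : Summable fun j => inner ℂ (v j) (A (v j)) := by
  refine Summable.of_norm_bounded (hv.mul_left ‖A‖) fun i => ?_
  refine (norm_inner_le_norm _ _).trans ?_
  have := A.le_opNorm (v i)
  nlinarith [norm_nonneg (v i)]

variable [CompleteSpace K]

/-- The trace of `ρ A` can be computed in any Hilbert basis. -/
theorem DensityOperator.exists_hasSum (ρ : DensityOperator K) :
    ∃ v : basisIndex K → K, (Summable fun j => ‖v j‖ ^ 2) ∧
      ∀ {ι : Type u} (b : HilbertBasis ι ℂ K) (A : K →L[ℂ] K),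
        HasSum (fun i => inner ℂ (b i) (ρ.op (A (b i)))) (∑' j, inner ℂ (v j) (A (v j))) := by
  set e := stdBasis K with he
  obtain ⟨s, hsa, hsq⟩ : ∃ s : K →L[ℂ] K, IsSelfAdjoint s ∧ s * s = ρ.op := by
    have h0 : 0 ≤ ρ.op := (ContinuousLinearMap.nonneg_iff_isPositive _).mpr ρ.pos
    exact ⟨CFC.sqrt ρ.op, (CFC.sqrt_nonneg ρ.op).isSelfAdjoint, CFC.sqrt_mul_sqrt_self ρ.op h0⟩
  have hs : ∀ x y, inner ℂ (s x) y = inner ℂ x (s y) := fun x y => hsa.isSymmetric x y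
  have hρ : ∀ x, ρ.op x = s (s x) := fun x => by rw [← hsq]; rfl
  have hsum : Summable fun i => ‖s (e i)‖ ^ 2 := by
    refine (Complex.hasSum_re ρ.hasSum_trace).summable.congr fun i => ?_
    rw [hρ, ← hs]
    exact inner_self_eq_norm_sq (𝕜 := ℂ) (s (e i))
  -- These vectors depend on ρ alone, so every basis `b` and every `A` yield the same right-hand
  -- side.
  refine ⟨fun i => s (e i), hsum, fun {ι} b A => ?_⟩
  have h1 := summable_norm_inner_sq_of_basis b (fun j => s (e j)) hsum
  have h2 := summable_norm_inner_sq_of_basis b (fun j => A.adjoint (s (e j))) <| by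
    refine Summable.of_nonneg_of_le (fun _ => by positivity) (fun i => ?_)
      (hsum.mul_left (‖A.adjoint‖ ^ 2))
    rw [← mul_pow]
    exact pow_le_pow_left₀ (norm_nonneg _) (A.adjoint.le_opNorm _) 2
  have h1' : Summable fun p : basisIndex K × ι => ‖inner ℂ (b p.2) (s (e p.1))‖ ^ 2 :=
    h1.congr fun p => by rw [norm_inner_symm]
  -- Both factors are square-summable because `s` is Hilbert-Schmidt, so the double series converges
  -- absolutely. Its sums over j and over i are the two Parseval expansions below, and exchanging
  -- them gives the claim.
  have h3 := summable_mul_of_sq _ _ h2 h1'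
  have hrow : ∀ i, HasSum (fun j =>
      inner ℂ (A.adjoint (s (e j))) (b i) * inner ℂ (b i) (s (e j)))
      (inner ℂ (b i) (ρ.op (A (b i)))) := by
    intro i
    have h := e.hasSum_inner_mul_inner (s (b i)) (s (A (b i)))
    rw [hs (b i), ← hρ] at h
    refine h.congr_fun fun j => ?_
    rw [ContinuousLinearMap.adjoint_inner_left, hs (b i), hs (e j), mul_comm]
  have hcol : ∀ j, HasSum (fun i =>
      inner ℂ (A.adjoint (s (e j))) (b i) * inner ℂ (b i) (s (e j)))
      (inner ℂ (s (e j)) (A (s (e j)))) := by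
    intro j
    have h := b.hasSum_inner_mul_inner (A.adjoint (s (e j))) (s (e j))
    rwa [ContinuousLinearMap.adjoint_inner_left] at h
  have hcols := h3.hasSum.prod_fiberwise hcol
  have hrows := ((Equiv.prodComm ι (basisIndex K)).hasSum_iff.mpr h3.hasSum).prod_fiberwise hrow
  rwa [hcols.tsum_eq]

theorem DensityOperator.exists_trace_eq (ρ : DensityOperator K) :
    ∃ v : basisIndex K → K, (Summable fun j => ‖v j‖ ^ 2) ∧
      ∀ A : K →L[ℂ] K, trace (ρ.op * A) = ∑' j, inner ℂ (v j) (A (v j)) := by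
  obtain ⟨v, hv, h⟩ := ρ.exists_hasSum
  exact ⟨v, hv, fun A => (h (stdBasis K) A).tsum_eq⟩

/-- Needed because `trace` uses a chosen basis of the whole space, which on a tensor product need
not consist of elementary tensors. -/
theorem DensityOperator.hasSum_trace_mul (ρ : DensityOperator K) {ι : Type u}
    (b : HilbertBasis ι ℂ K) (A : K →L[ℂ] K) :
    HasSum (fun i => inner ℂ (b i) (ρ.op (A (b i)))) (trace (ρ.op * A)) := by
  obtain ⟨v, hv, h⟩ := ρ.exists_hasSum
  have h' : trace (ρ.op * A) = ∑' j, inner ℂ (v j) (A (v j)) := (h (stdBasis K) A).tsum_eq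
  rw [h']
  exact h b A

/-- The expectation functional `A ↦ tr (ρ A)`. -/
noncomputable def DensityOperator.traceL (ρ : DensityOperator K) : (K →L[ℂ] K) →ₗ[ℂ] ℂ where
  toFun A := trace (ρ.op * A)
  map_add' A B := by
    obtain ⟨v, hv, h⟩ := ρ.exists_trace_eq
    simp only [h, add_apply, inner_add_right]
    exact (summable_inner_apply hv A).tsum_add (summable_inner_apply hv B)
  map_smul' c A := by
    obtain ⟨v, hv, h⟩ := ρ.exists_trace_eq
    simp only [h, smul_apply, inner_smul_right, tsum_mul_left,
      RingHom.id_apply, smul_eq_mul]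

theorem DensityOperator.traceL_apply (ρ : DensityOperator K) (A : K →L[ℂ] K) :
    ρ.traceL A = trace (ρ.op * A) := rfl

theorem DensityOperator.traceL_one (ρ : DensityOperator K) : ρ.traceL 1 = 1 := by
  rw [ρ.traceL_apply, mul_one]
  exact ρ.hasSum_trace.tsum_eq

theorem DensityOperator.traceL_re_nonneg (ρ : DensityOperator K) {A : K →L[ℂ] K}
    (hA : A.IsPositive) : 0 ≤ (ρ.traceL A).re := by
  obtain ⟨v, hv, h⟩ := ρ.exists_trace_eq
  rw [ρ.traceL_apply, h, Complex.re_tsum (summable_inner_apply hv A)]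
  exact tsum_nonneg fun j => hA.re_inner_nonneg_right _

end Trace

/-! ### Operators, positivity and bases on Hilbert tensor products. -/

section Tensor

variable {E F : Type*} [NormedAddCommGroup E] [InnerProductSpace ℂ E]
  [NormedAddCommGroup F] [InnerProductSpace ℂ F]

theorem inner_pureTensor (x x' : E) (y y' : F) :
    inner ℂ (pureTensor x y) (pureTensor x' y') = inner ℂ x x' * inner ℂ y y' := by
  simp [pureTensor, Completion.inner_coe]

/-- The elementary tensor as a continuous bilinear map. -/
noncomputable def pureTensorL (E F : Type*) [NormedAddCommGroup E] [InnerProductSpace ℂ E]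
    [NormedAddCommGroup F] [InnerProductSpace ℂ F] : E →L[ℂ] F →L[ℂ] HTensor E F :=
  (ContinuousLinearMap.compL ℂ F (E ⊗[ℂ] F) (HTensor E F) Completion.toComplL).comp
    (TensorProduct.mkL ℂ E F)

@[simp]
theorem pureTensorL_apply (x : E) (y : F) : pureTensorL E F x y = pureTensor x y := rfl

theorem pureTensor_add_left (x x' : E) (y : F) :
    pureTensor (x + x') y = pureTensor x y + pureTensor x' y := by
  simp only [← pureTensorL_apply, map_add, add_apply]

theorem pureTensor_add_right (x : E) (y y' : F) :
    pureTensor x (y + y') = pureTensor x y + pureTensor x y' := by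
  simp only [← pureTensorL_apply, map_add]

theorem pureTensor_smul_left (c : ℂ) (x : E) (y : F) :
    pureTensor (c • x) y = c • pureTensor x y := by
  simp only [← pureTensorL_apply, map_smul, smul_apply]

theorem pureTensor_smul_right (c : ℂ) (x : E) (y : F) :
    pureTensor x (c • y) = c • pureTensor x y := by
  simp only [← pureTensorL_apply, map_smul]

/-- Continuous linear maps on the Hilbert tensor product agree if they agree on elementary
tensors. -/
theorem htensor_ext {G : Type*} [NormedAddCommGroup G] [NormedSpace ℂ G]
    {f g : HTensor E F →L[ℂ] G} (h : ∀ x y, f (pureTensor x y) = g (pureTensor x y)) : f = g := by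
  ext z
  induction z using Completion.induction_on with
  | hp => exact isClosed_eq f.continuous g.continuous
  | ih z =>
    induction z using TensorProduct.induction_on with
    | zero => exact (map_zero f).trans (map_zero g).symm
    | tmul x y => exact h x y
    | add a b ha hb => exact (congrArg f (Completion.coe_add a b)).trans <| (map_add f _ _).trans <|
      (congrArg₂ (· + ·) ha hb).trans <| (map_add g _ _).symm.trans <|
      (congrArg g (Completion.coe_add a b)).symm

theorem tensorOp_add_left (A A' : E →L[ℂ] E) (B : F →L[ℂ] F) :
    tensorOp (A + A') B = tensorOp A B + tensorOp A' B :=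
  htensor_ext fun x y => by simp only [add_apply, tensorOp_pureTensor, pureTensor_add_left]

theorem tensorOp_add_right (A : E →L[ℂ] E) (B B' : F →L[ℂ] F) :
    tensorOp A (B + B') = tensorOp A B + tensorOp A B' :=
  htensor_ext fun x y => by simp only [add_apply, tensorOp_pureTensor, pureTensor_add_right]

theorem tensorOp_smul_left (c : ℂ) (A : E →L[ℂ] E) (B : F →L[ℂ] F) :
    tensorOp (c • A) B = c • tensorOp A B :=
  htensor_ext fun x y => by simp only [smul_apply, tensorOp_pureTensor, pureTensor_smul_left]

theorem tensorOp_smul_right (c : ℂ) (A : E →L[ℂ] E) (B : F →L[ℂ] F) :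
    tensorOp A (c • B) = c • tensorOp A B :=
  htensor_ext fun x y => by simp only [smul_apply, tensorOp_pureTensor, pureTensor_smul_right]

/-- `(A, B) ↦ A ⊗ B` as a bilinear map. -/
noncomputable def tensorOpL (E F : Type*) [NormedAddCommGroup E] [InnerProductSpace ℂ E]
    [NormedAddCommGroup F] [InnerProductSpace ℂ F] :
    (E →L[ℂ] E) →ₗ[ℂ] (F →L[ℂ] F) →ₗ[ℂ] (HTensor E F →L[ℂ] HTensor E F) :=
  LinearMap.mk₂ ℂ tensorOp tensorOp_add_left tensorOp_smul_left tensorOp_add_right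
    tensorOp_smul_right

@[simp]
theorem tensorOpL_apply (A : E →L[ℂ] E) (B : F →L[ℂ] F) : tensorOpL E F A B = tensorOp A B := rfl

theorem tensorOp_one_one : tensorOp (1 : E →L[ℂ] E) (1 : F →L[ℂ] F) = 1 :=
  htensor_ext fun x y => by simp [tensorOp_pureTensor]

theorem tensorOp_mul (A A' : E →L[ℂ] E) (B B' : F →L[ℂ] F) :
    tensorOp (A * A') (B * B') = tensorOp A B * tensorOp A' B' :=
  htensor_ext fun x y => by simp [tensorOp_pureTensor]

theorem adjoint_tensorOp [CompleteSpace E] [CompleteSpace F] (A : E →L[ℂ] E) (B : F →L[ℂ] F) :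
    (tensorOp A B).adjoint = tensorOp A.adjoint B.adjoint := by
  refine htensor_ext fun x y => ?_
  refine ext_inner_right ℂ fun w => ?_
  have : innerSL ℂ ((tensorOp A B).adjoint (pureTensor x y)) =
      innerSL ℂ (tensorOp A.adjoint B.adjoint (pureTensor x y)) :=
    htensor_ext fun x' y' => by
      simp only [innerSL_apply_apply, ContinuousLinearMap.adjoint_inner_left, tensorOp_pureTensor,
        inner_pureTensor]
  exact congrArg (fun f => f w) this

theorem _root_.ContinuousLinearMap.IsPositive.exists_adjoint_mul_self [CompleteSpace E]
    {A : E →L[ℂ] E} (hA : A.IsPositive) : ∃ s : E →L[ℂ] E, s.adjoint * s = A := by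
  have h0 : 0 ≤ A := (ContinuousLinearMap.nonneg_iff_isPositive _).mpr hA
  refine ⟨CFC.sqrt A, ?_⟩
  rw [(CFC.sqrt_nonneg A).isSelfAdjoint.adjoint_eq, CFC.sqrt_mul_sqrt_self A h0]

/-- Writing A = s*s and B = t*t gives A ⊗ B = (s ⊗ t)*(s ⊗ t). -/
theorem tensorOp_isPositive [CompleteSpace E] [CompleteSpace F] {A : E →L[ℂ] E} {B : F →L[ℂ] F}
    (hA : A.IsPositive) (hB : B.IsPositive) : (tensorOp A B).IsPositive := by
  obtain ⟨s, rfl⟩ := hA.exists_adjoint_mul_self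
  obtain ⟨t, rfl⟩ := hB.exists_adjoint_mul_self
  rw [tensorOp_mul, ← adjoint_tensorOp]
  exact ContinuousLinearMap.isPositive_adjoint_comp_self _

theorem orthonormal_pureTensor {ι κ : Type*} {b : ι → E} {c : κ → F} (hb : Orthonormal ℂ b)
    (hc : Orthonormal ℂ c) : Orthonormal ℂ fun p : ι × κ => pureTensor (b p.1) (c p.2) := by
  classical
  rw [orthonormal_iff_ite] at *
  rintro ⟨i, j⟩ ⟨i', j'⟩
  simp only [inner_pureTensor, hb, hc, Prod.mk.injEq]
  split_ifs <;> simp_all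

theorem eq_zero_of_hilbertBasis {ι G : Type*} [NormedAddCommGroup G] [NormedSpace ℂ G]
    (b : HilbertBasis ι ℂ E) {f : E →L[ℂ] G} (h : ∀ i, f (b i) = 0) : f = 0 := by
  refine ContinuousLinearMap.ext_on
    (Submodule.dense_iff_topologicalClosure_eq_top.mpr b.dense_span) ?_
  rintro _ ⟨i, rfl⟩
  simp [h]

/-- The product Hilbert basis of a Hilbert tensor product. -/
noncomputable def tensorBasis {ι κ : Type*} (b : HilbertBasis ι ℂ E) (c : HilbertBasis κ ℂ F) :
    HilbertBasis (ι × κ) ℂ (HTensor E F) :=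
  HilbertBasis.mkOfOrthogonalEqBot (orthonormal_pureTensor b.orthonormal c.orthonormal) <| by
    rw [Submodule.eq_bot_iff]
    intro z hz
    have h0 : ∀ i j, inner ℂ z (pureTensor (b i) (c j)) = 0 := fun i j =>
      (Submodule.mem_orthogonal' _ _).mp hz _ (Submodule.subset_span ⟨(i, j), rfl⟩)
    -- The bounded bilinear form (x, y) ↦ ⟪z, x ⊗ y⟫ vanishes on pairs of basis vectors, hence
    -- everywhere by density in each variable; then z is orthogonal to all elementary tensors.
    have h1 : (ContinuousLinearMap.compL ℂ F (HTensor E F) ℂ (innerSL ℂ z)).comp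
        (pureTensorL E F) = 0 :=
      eq_zero_of_hilbertBasis b fun i => eq_zero_of_hilbertBasis c fun j => h0 i j
    have h2 : innerSL ℂ z = 0 :=
      htensor_ext fun x y => congrArg (fun f => f x y) h1
    exact inner_self_eq_zero.mp (congrArg (fun f => f z) h2)

@[simp]
theorem tensorBasis_apply {ι κ : Type*} (b : HilbertBasis ι ℂ E) (c : HilbertBasis κ ℂ F)
    (p : ι × κ) : tensorBasis b c p = pureTensor (b p.1) (c p.2) := by
  simp [tensorBasis]

end Tensor

/-! ### Partial traces as identities between expectations. -/

section PartialTrace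

variable {H : Type u} [NormedAddCommGroup H] [InnerProductSpace ℂ H] [CompleteSpace H]

theorem hasSum_traceL_tensorOp (ρ : DensityOperator (HTensor H H)) (X Y : H →L[ℂ] H) :
    HasSum (fun p : basisIndex H × basisIndex H =>
      inner ℂ (pureTensor (stdBasis H p.1) (stdBasis H p.2))
        (ρ.op (pureTensor (X (stdBasis H p.1)) (Y (stdBasis H p.2)))))
      (ρ.traceL (tensorOp X Y)) := by
  have h := ρ.hasSum_trace_mul (tensorBasis (stdBasis H) (stdBasis H)) (tensorOp X Y)
  simp only [tensorBasis_apply, tensorOp_pureTensor] at h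
  exact h

theorem hasSum_traceL_tensorOp₃ (T : DensityOperator (HTensor (HTensor H H) H))
    (X Y Z : H →L[ℂ] H) :
    HasSum (fun p : (basisIndex H × basisIndex H) × basisIndex H =>
      inner ℂ (pureTensor₃ (stdBasis H p.1.1) (stdBasis H p.1.2) (stdBasis H p.2))
        (T.op (pureTensor₃ (X (stdBasis H p.1.1)) (Y (stdBasis H p.1.2)) (Z (stdBasis H p.2)))))
      (T.traceL (tensorOp (tensorOp X Y) Z)) := by
  have h := T.hasSum_trace_mul (tensorBasis (tensorBasis (stdBasis H) (stdBasis H)) (stdBasis H))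
    (tensorOp (tensorOp X Y) Z)
  simp only [tensorBasis_apply, tensorOp_pureTensor] at h
  exact h

variable {T : DensityOperator (HTensor (HTensor H H) H)} {ρ : DensityOperator (HTensor H H)}

/-- Both traces are expanded in product bases. Summing the triple series first over the traced index
produces, term by term, the matrix elements of the partial trace. -/
theorem IsPartialTrace₁.traceL_eq (h : IsPartialTrace₁ T.op ρ.op) (X Y : H →L[ℂ] H) :
    ρ.traceL (tensorOp X Y) = T.traceL (tensorOp (tensorOp 1 X) Y) := by
  -- The reindexing moves the traced index to the last coordinate, the one `prod_fiberwise` sums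
  -- first.
  let e : (basisIndex H × basisIndex H) × basisIndex H ≃
      (basisIndex H × basisIndex H) × basisIndex H :=
    ⟨fun p => ((p.2, p.1.1), p.1.2), fun p => ((p.1.2, p.2), p.1.1), fun _ => rfl, fun _ => rfl⟩
  have hT := e.hasSum_iff.mpr (hasSum_traceL_tensorOp₃ T 1 X Y)
  refine (hasSum_traceL_tensorOp ρ X Y).unique (hT.prod_fiberwise fun p => ?_)
  exact h (stdBasis H p.1) (stdBasis H p.2) (X (stdBasis H p.1)) (Y (stdBasis H p.2))

theorem IsPartialTrace₂.traceL_eq (h : IsPartialTrace₂ T.op ρ.op) (X Y : H →L[ℂ] H) :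
    ρ.traceL (tensorOp X Y) = T.traceL (tensorOp (tensorOp X 1) Y) := by
  let e : (basisIndex H × basisIndex H) × basisIndex H ≃
      (basisIndex H × basisIndex H) × basisIndex H :=
    ⟨fun p => ((p.1.1, p.2), p.1.2), fun p => ((p.1.1, p.2), p.1.2), fun _ => rfl, fun _ => rfl⟩
  have hT := e.hasSum_iff.mpr (hasSum_traceL_tensorOp₃ T X 1 Y)
  refine (hasSum_traceL_tensorOp ρ X Y).unique (hT.prod_fiberwise fun p => ?_)
  exact h (stdBasis H p.1) (stdBasis H p.2) (X (stdBasis H p.1)) (Y (stdBasis H p.2))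

theorem IsPartialTrace₃.traceL_eq (h : IsPartialTrace₃ T.op ρ.op) (X Y : H →L[ℂ] H) :
    ρ.traceL (tensorOp X Y) = T.traceL (tensorOp (tensorOp X Y) 1) := by
  have hT := hasSum_traceL_tensorOp₃ T X Y 1
  refine (hasSum_traceL_tensorOp ρ X Y).unique (hT.prod_fiberwise fun p => ?_)
  exact h (stdBasis H p.1) (stdBasis H p.2) (X (stdBasis H p.1)) (Y (stdBasis H p.2))

end PartialTrace

/-! ### Rounding outcomes, and bounds in the operator order. -/

theorem integral_comp_eq_sum {Ω κ : Type*} [MeasurableSpace Ω] [MeasurableSpace κ]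
    [MeasurableSingletonClass κ] (μ : Measure Ω) [IsFiniteMeasure μ] {f : Ω → κ}
    (hf : Measurable f) (s : Finset κ) (hs : ∀ x, f x ∈ s) (g : κ → ℝ) :
    ∫ x, g (f x) ∂μ = ∑ k ∈ s, g k * μ.real (f ⁻¹' {k}) := by
  classical
  have hm : ∀ k, MeasurableSet (f ⁻¹' {k}) := fun k => hf (measurableSet_singleton k)
  have h : ∀ x, g (f x) = ∑ k ∈ s, (f ⁻¹' {k}).indicator (fun _ => g k) x := by
    intro x
    simp only [Set.indicator_apply, Set.mem_preimage, Set.mem_singleton_iff]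
    rw [Finset.sum_ite_eq, if_pos (hs x)]
  simp only [h]
  rw [integral_finsetSum _ fun k _ => (integrable_const (g k)).indicator (hm k)]
  refine Finset.sum_congr rfl fun k _ => ?_
  rw [integral_indicator_const _ (hm k), smul_eq_mul, mul_comm]

/-- Over ℂ, a real quadratic form already forces the operator to be symmetric. -/
theorem isPositive_of_inner_eq {K : Type*} [NormedAddCommGroup K] [InnerProductSpace ℂ K]
    {A : K →L[ℂ] K} {q : K → ℝ} (h : ∀ ψ, inner ℂ ψ (A ψ) = (q ψ : ℂ)) (hq : ∀ ψ, 0 ≤ q ψ) :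
    A.IsPositive := by
  rw [ContinuousLinearMap.isPositive_iff_complex]
  intro ψ
  have h' : inner ℂ (A ψ) ψ = (q ψ : ℂ) := by
    rw [← inner_conj_symm, h, Complex.conj_ofReal]
  rw [h']
  exact ⟨rfl, hq ψ⟩

section Discretization

/-- The index of the cell of width `1 / n` that contains an outcome. -/
noncomputable def cell {Λ : Set ℝ} (n : ℕ) (x : Λ) : ℤ := ⌊(n : ℝ) * (x : ℝ)⌋

variable {Λ : Set ℝ}

theorem measurable_cell (n : ℕ) : Measurable (cell (Λ := Λ) n) :=
  Int.measurable_floor.comp (measurable_subtype_coe.const_mul _)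

/-- The index n cannot be dropped: the outcome 1 falls in that cell. -/
theorem cell_mem (hΛ : Λ ⊆ Set.Icc (-1) 1) (n : ℕ) (x : Λ) :
    cell n x ∈ Finset.Icc (-(n : ℤ)) n := by
  obtain ⟨h1, h2⟩ := hΛ x.2
  have hn : (0 : ℝ) ≤ n := n.cast_nonneg
  rw [Finset.mem_Icc, cell, Int.le_floor, ← @Int.cast_le ℝ]
  push_cast
  exact ⟨by nlinarith, (Int.floor_le _).trans (by nlinarith)⟩

theorem abs_cell_div_sub_le {n : ℕ} (hn : 0 < n) (x : Λ) :
    |(cell n x : ℝ) / n - x| ≤ 1 / n := by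
  have hn' : (0 : ℝ) < n := Nat.cast_pos.mpr hn
  have h1 := Int.floor_le ((n : ℝ) * (x : ℝ))
  have h2 := Int.lt_floor_add_one ((n : ℝ) * (x : ℝ))
  have : (cell n x : ℝ) / n - x = ((cell n x : ℝ) - n * x) / n := by field_simp
  rw [this, abs_div, abs_of_pos hn']
  gcongr
  rw [cell, abs_le]
  constructor <;> linarith

theorem abs_cell_div_le_one (hΛ : Λ ⊆ Set.Icc (-1) 1) {n : ℕ} (hn : 0 < n) (x : Λ) :
    |(cell n x : ℝ) / n| ≤ 1 := by
  have hn' : (0 : ℝ) < n := Nat.cast_pos.mpr hn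
  have h := Finset.mem_Icc.mp (cell_mem hΛ n x)
  rw [abs_div, abs_of_pos hn', div_le_one hn', abs_le]
  exact ⟨by exact_mod_cast h.1, by exact_mod_cast h.2⟩

variable {K : Type*} [NormedAddCommGroup K] [InnerProductSpace ℂ K]

/-- The average of the outcomes, rounded to multiples of `1 / n`. -/
noncomputable def POVM.roundedAverage (M : POVM Λ K) (n : ℕ) : K →L[ℂ] K :=
  ∑ k ∈ Finset.Icc (-(n : ℤ)) n, (((k : ℝ) / n : ℝ) : ℂ) • M.effect (cell n ⁻¹' {k})

namespace POVM

theorem inner_effect {Ω : Type*} [MeasurableSpace Ω] (M : POVM Ω K) {B : Set Ω}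
    (hB : MeasurableSet B) (ψ : K) :
    inner ℂ ψ (M.effect B ψ) = ((M.vectorLaw ψ).real B : ℂ) := by
  rw [Measure.real, M.vectorLaw_apply ψ hB, ENNReal.toReal_ofReal (M.re_inner_nonneg hB ψ)]
  have h := (M.pos B hB).inner_nonneg_right ψ
  exact Complex.ext (Complex.ofReal_re _).symm
    ((Complex.nonneg_iff.mp h).2.symm.trans (Complex.ofReal_im _).symm)

theorem vectorLaw_univ {Ω : Type*} [MeasurableSpace Ω] (M : POVM Ω K) (ψ : K) :
    M.vectorLaw ψ Set.univ = ENNReal.ofReal (‖ψ‖ ^ 2) := by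
  rw [M.vectorLaw_apply ψ MeasurableSet.univ, M.univ]
  congr 1
  exact inner_self_eq_norm_sq (𝕜 := ℂ) ψ

instance isFiniteMeasure_vectorLaw {Ω : Type*} [MeasurableSpace Ω] (M : POVM Ω K) (ψ : K) :
    IsFiniteMeasure (M.vectorLaw ψ) :=
  ⟨by rw [M.vectorLaw_univ]; exact ENNReal.ofReal_lt_top⟩

theorem vectorLaw_real_univ {Ω : Type*} [MeasurableSpace Ω] (M : POVM Ω K) (ψ : K) :
    (M.vectorLaw ψ).real Set.univ = ‖ψ‖ ^ 2 := by
  rw [Measure.real, M.vectorLaw_univ, ENNReal.toReal_ofReal (by positivity)]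

/-- Reduces operator bounds on rounded averages to pointwise bounds on the rounding function. -/
theorem inner_roundedAverage (M : POVM Λ K) (hΛ : Λ ⊆ Set.Icc (-1) 1) (n : ℕ) (ψ : K) :
    inner ℂ ψ (M.roundedAverage n ψ) =
      ((∫ x, (cell n x : ℝ) / n ∂(M.vectorLaw ψ) : ℝ) : ℂ) := by
  rw [integral_comp_eq_sum (M.vectorLaw ψ) (measurable_cell n) _ (cell_mem hΛ n)
    fun k => (k : ℝ) / n, roundedAverage, sum_apply, inner_sum,
    Complex.ofReal_sum]
  refine Finset.sum_congr rfl fun k _ => ?_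
  rw [smul_apply, inner_smul_right, Complex.ofReal_mul,
    M.inner_effect (measurable_cell n (measurableSet_singleton k))]

theorem abs_integral_le (M : POVM Λ K) (ψ : K) {f : Λ → ℝ} {C : ℝ} (hf : ∀ x, |f x| ≤ C) :
    |∫ x, f x ∂(M.vectorLaw ψ)| ≤ C * ‖ψ‖ ^ 2 := by
  have h := norm_integral_le_of_norm_le_const (μ := M.vectorLaw ψ)
    (Filter.Eventually.of_forall fun x => (Real.norm_eq_abs (f x)).trans_le (hf x))
  rwa [M.vectorLaw_real_univ] at h

end POVM

/-- `-c ≤ A ≤ c` in the operator order. -/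
def OpBound (A : K →L[ℂ] K) (c : ℝ) : Prop :=
  ((c : ℂ) • (1 : K →L[ℂ] K) + A).IsPositive ∧ ((c : ℂ) • (1 : K →L[ℂ] K) - A).IsPositive

theorem opBound_of_inner_eq {A : K →L[ℂ] K} {c : ℝ} {q : K → ℝ}
    (h : ∀ ψ, inner ℂ ψ (A ψ) = (q ψ : ℂ)) (hq : ∀ ψ, |q ψ| ≤ c * ‖ψ‖ ^ 2) : OpBound A c := by
  have h1 : ∀ ψ : K, inner ℂ ψ (((c : ℂ) • (1 : K →L[ℂ] K)) ψ) = ((c * ‖ψ‖ ^ 2 : ℝ) : ℂ) := by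
    intro ψ
    rw [smul_apply, inner_smul_right, one_apply_eq_self, inner_self_eq_norm_sq_to_K]
    push_cast
    rfl
  constructor
  · refine isPositive_of_inner_eq (q := fun ψ => c * ‖ψ‖ ^ 2 + q ψ) (fun ψ => ?_) fun ψ => ?_
    · rw [add_apply, inner_add_right, h, h1, Complex.ofReal_add]
    · linarith [(abs_le.mp (hq ψ)).1]
  · refine isPositive_of_inner_eq (q := fun ψ => c * ‖ψ‖ ^ 2 - q ψ) (fun ψ => ?_) fun ψ => ?_
    · rw [sub_apply, inner_sub_right, h, h1, Complex.ofReal_sub]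
    · linarith [(abs_le.mp (hq ψ)).2]

theorem POVM.opBound_roundedAverage (M : POVM Λ K) (hΛ : Λ ⊆ Set.Icc (-1) 1) {n : ℕ}
    (hn : 0 < n) : OpBound (M.roundedAverage n) 1 :=
  opBound_of_inner_eq (M.inner_roundedAverage hΛ n) fun ψ =>
    M.abs_integral_le ψ (abs_cell_div_le_one hΛ hn)

theorem POVM.IsAverage.opBound {M : POVM Λ K} (hΛ : Λ ⊆ Set.Icc (-1) 1) {W : K →L[ℂ] K}
    (hW : M.IsAverage W) : OpBound W 1 :=
  opBound_of_inner_eq hW fun ψ => M.abs_integral_le ψ fun x => abs_le.mpr (hΛ x.2)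

theorem integrable_coe (hΛ : Λ ⊆ Set.Icc (-1) 1) (μ : Measure Λ) [IsFiniteMeasure μ] :
    Integrable (fun x : Λ => (x : ℝ)) μ :=
  .of_bound measurable_subtype_coe.aestronglyMeasurable 1
    (Filter.Eventually.of_forall fun x => abs_le.mpr (hΛ x.2))

theorem integrable_cell_div (hΛ : Λ ⊆ Set.Icc (-1) 1) {n : ℕ} (hn : 0 < n) (μ : Measure Λ)
    [IsFiniteMeasure μ] : Integrable (fun x : Λ => (cell n x : ℝ) / n) μ :=
  .of_bound ((measurable_from_top.comp (measurable_cell n)).div_const _).aestronglyMeasurable 1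
    (Filter.Eventually.of_forall fun x => abs_cell_div_le_one hΛ hn x)

/-- Rounding moves each outcome by at most 1/n, and the law in ψ has total mass ‖ψ‖². -/
theorem POVM.IsAverage.opBound_roundedAverage_sub {M : POVM Λ K} (hΛ : Λ ⊆ Set.Icc (-1) 1)
    {W : K →L[ℂ] K} (hW : M.IsAverage W) {n : ℕ} (hn : 0 < n) :
    OpBound (M.roundedAverage n - W) (1 / n) := by
  refine opBound_of_inner_eq
    (q := fun ψ => ∫ x, ((cell n x : ℝ) / n - (x : ℝ)) ∂(M.vectorLaw ψ)) (fun ψ => ?_)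
    fun ψ => M.abs_integral_le ψ (abs_cell_div_sub_le hn)
  rw [sub_apply, inner_sub_right, M.inner_roundedAverage hΛ, hW,
    integral_sub (integrable_cell_div hΛ hn _) (integrable_coe hΛ _), Complex.ofReal_sub]

end Discretization

/-! ### Correlations of rounded outcomes. -/

section OutcomeLaw

variable {K : Type u} [NormedAddCommGroup K] [InnerProductSpace ℂ K] [CompleteSpace K]
  {Ω : Type*} [MeasurableSpace Ω]

theorem outcomeLaw_apply (ρ : DensityOperator K) (M : POVM Ω K) {B : Set Ω}
    (hB : MeasurableSet B) :
    outcomeLaw ρ M B = ENNReal.ofReal (ρ.traceL (M.effect B)).re :=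
  Measure.ofMeasurable_apply B hB

theorem outcomeLaw_real (ρ : DensityOperator K) (M : POVM Ω K) {B : Set Ω}
    (hB : MeasurableSet B) : (outcomeLaw ρ M).real B = (ρ.traceL (M.effect B)).re := by
  rw [Measure.real, outcomeLaw_apply ρ M hB,
    ENNReal.toReal_ofReal (ρ.traceL_re_nonneg (M.pos B hB))]

instance isProbabilityMeasure_outcomeLaw (ρ : DensityOperator K) (M : POVM Ω K) :
    IsProbabilityMeasure (outcomeLaw ρ M) :=
  ⟨by rw [outcomeLaw_apply ρ M MeasurableSet.univ, M.univ, ρ.traceL_one]; simp⟩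

variable {H : Type u} [NormedAddCommGroup H] [InnerProductSpace ℂ H] [CompleteSpace H]
  {Λ₁ Λ₂ : Set ℝ}

/-- The rounded product is constant on rectangles of cells, and on rectangles `IsJoint` gives the
joint effects as tensor products. -/
theorem integral_cell_mul_cell (hΛ₁ : Λ₁ ⊆ Set.Icc (-1) 1) (hΛ₂ : Λ₂ ⊆ Set.Icc (-1) 1)
    {M₁ : POVM Λ₁ H} {M₂ : POVM Λ₂ H} {M : POVM (Λ₁ × Λ₂) (HTensor H H)}
    (hM : IsJoint M₁ M₂ M) (ρ : DensityOperator (HTensor H H)) (n : ℕ) :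
    ∫ x, ((cell n x.1 : ℝ) / n) * ((cell n x.2 : ℝ) / n) ∂(outcomeLaw ρ M) =
      (ρ.traceL (tensorOp (M₁.roundedAverage n) (M₂.roundedAverage n))).re := by
  rw [integral_comp_eq_sum (f := fun x : Λ₁ × Λ₂ => (cell n x.1, cell n x.2)) (outcomeLaw ρ M)
    (((measurable_cell n).comp measurable_fst).prodMk ((measurable_cell n).comp measurable_snd))
    (Finset.Icc (-(n : ℤ)) n ×ˢ Finset.Icc (-(n : ℤ)) n)
    (fun x => Finset.mem_product.mpr ⟨cell_mem hΛ₁ n x.1, cell_mem hΛ₂ n x.2⟩)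
    fun k => ((k.1 : ℝ) / n) * ((k.2 : ℝ) / n), Finset.sum_product_right]
  rw [← tensorOpL_apply, POVM.roundedAverage, POVM.roundedAverage, map_sum, map_sum,
    Complex.re_sum]
  refine Finset.sum_congr rfl fun l _ => ?_
  rw [map_sum, LinearMap.sum_apply, map_sum, Complex.re_sum]
  refine Finset.sum_congr rfl fun k _ => ?_
  have hk := measurable_cell (Λ := Λ₁) n (measurableSet_singleton k)
  have hl := measurable_cell (Λ := Λ₂) n (measurableSet_singleton l)
  have hset : (fun x : Λ₁ × Λ₂ => (cell n x.1, cell n x.2)) ⁻¹' {(k, l)} =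
      (cell n ⁻¹' {k}) ×ˢ (cell n ⁻¹' {l}) := by
    ext x
    simp
  rw [hset, outcomeLaw_real ρ M (hk.prod hl), hM _ _ hk hl, map_smul, map_smul, map_smul,
    LinearMap.smul_apply, map_smul, tensorOpL_apply, smul_eq_mul, smul_eq_mul, Complex.re_ofReal_mul,
    Complex.re_ofReal_mul]
  ring

theorem abs_productExpectation_sub_le (hΛ₁ : Λ₁ ⊆ Set.Icc (-1) 1) (hΛ₂ : Λ₂ ⊆ Set.Icc (-1) 1)
    {M₁ : POVM Λ₁ H} {M₂ : POVM Λ₂ H} {M : POVM (Λ₁ × Λ₂) (HTensor H H)}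
    (hM : IsJoint M₁ M₂ M) (ρ : DensityOperator (HTensor H H)) {n : ℕ} (hn : 0 < n) :
    |productExpectation ρ M -
      (ρ.traceL (tensorOp (M₁.roundedAverage n) (M₂.roundedAverage n))).re| ≤ 2 / n := by
  have hm : ∀ {Λ : Set ℝ}, Measurable fun x : Λ => (cell n x : ℝ) / n := fun {Λ} =>
    (measurable_from_top.comp (measurable_cell n)).div_const _
  have h1 : Integrable (fun x : Λ₁ × Λ₂ => (x.1 : ℝ) * (x.2 : ℝ)) (outcomeLaw ρ M) := by
    refine .of_bound ((measurable_subtype_coe.comp measurable_fst).mul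
      (measurable_subtype_coe.comp measurable_snd)).aestronglyMeasurable 1
      (Filter.Eventually.of_forall fun x => ?_)
    rw [Real.norm_eq_abs, abs_mul]
    exact mul_le_one₀ (abs_le.mpr (hΛ₁ x.1.2)) (abs_nonneg _) (abs_le.mpr (hΛ₂ x.2.2))
  have h2 : Integrable (fun x : Λ₁ × Λ₂ => ((cell n x.1 : ℝ) / n) * ((cell n x.2 : ℝ) / n))
      (outcomeLaw ρ M) := by
    refine .of_bound ((hm.comp measurable_fst).mul (hm.comp measurable_snd)).aestronglyMeasurable 1
      (Filter.Eventually.of_forall fun x => ?_)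
    rw [Real.norm_eq_abs, abs_mul]
    exact mul_le_one₀ (abs_cell_div_le_one hΛ₁ hn _) (abs_nonneg _)
      (abs_cell_div_le_one hΛ₂ hn _)
  rw [← integral_cell_mul_cell hΛ₁ hΛ₂ hM, productExpectation, ← integral_sub h1 h2]
  have h := norm_integral_le_of_norm_le_const (μ := outcomeLaw ρ M) (C := 2 / n)
    (f := fun x => (x.1 : ℝ) * (x.2 : ℝ) - ((cell n x.1 : ℝ) / n) * ((cell n x.2 : ℝ) / n))
    (Filter.Eventually.of_forall fun x => by
      -- One factor is rounded at a time; each change costs 1/n since the other factor is at most 1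
      -- in modulus.
      have e : (x.1 : ℝ) * (x.2 : ℝ) - ((cell n x.1 : ℝ) / n) * ((cell n x.2 : ℝ) / n) =
          -(((cell n x.1 : ℝ) / n - x.1) * x.2) -
            ((cell n x.1 : ℝ) / n) * ((cell n x.2 : ℝ) / n - x.2) := by ring
      have a1 := mul_le_mul (abs_cell_div_sub_le hn x.1) (abs_le.mpr (hΛ₂ x.2.2))
        (abs_nonneg _) (by positivity)
      have a2 := mul_le_mul (abs_cell_div_le_one hΛ₁ hn x.1) (abs_cell_div_sub_le hn x.2)
        (abs_nonneg _) zero_le_one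
      rw [← abs_mul] at a1 a2
      rw [e, Real.norm_eq_abs]
      refine (abs_sub _ _).trans ?_
      rw [abs_neg]
      refine (add_le_add a1 a2).trans (le_of_eq ?_)
      ring)
  simpa using h

/-! ### Bell inequality for operators. -/

theorem abs_traceL_tensorOp_le (ρ : DensityOperator (HTensor H H)) {A B : H →L[ℂ] H} {c d : ℝ}
    (hA : OpBound A c) (hB : OpBound B d) : |(ρ.traceL (tensorOp A B)).re| ≤ c * d := by
  -- In `h1 + h2` and `h3 + h4` the terms linear in A or B cancel, leaving 2(cd ± Re tr ρ(A ⊗ B)).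
  have h1 := ρ.traceL_re_nonneg (tensorOp_isPositive hA.1 hB.1)
  have h2 := ρ.traceL_re_nonneg (tensorOp_isPositive hA.2 hB.2)
  have h3 := ρ.traceL_re_nonneg (tensorOp_isPositive hA.1 hB.2)
  have h4 := ρ.traceL_re_nonneg (tensorOp_isPositive hA.2 hB.1)
  simp only [← tensorOpL_apply, map_add, map_sub, map_smul,
    LinearMap.add_apply, LinearMap.sub_apply, LinearMap.smul_apply, smul_add, smul_sub,
    Complex.add_re, Complex.sub_re, smul_eq_mul, Complex.re_ofReal_mul] at h1 h2 h3 h4 ⊢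
  rw [tensorOpL_apply 1 1, tensorOp_one_one, ρ.traceL_one, Complex.one_re] at h1 h2 h3 h4
  rw [abs_le]
  constructor <;> linarith

/-- The Bell inequality for a trilinear form that is nonnegative on positive arguments. -/
theorem abs_sub_le_of_trilinear {V : Type*} [AddCommGroup V] (τ : V →+ V →+ V →+ ℝ) {P : V → Prop}
    (hτ : ∀ x y z, P x → P y → P z → 0 ≤ τ x y z) {e A W B : V} (he : τ e e e = 1)
    (hA : P (e + A)) (hA' : P (e - A)) (hW : P (e + W)) (hW' : P (e - W))
    (hB : P (e + B)) (hB' : P (e - B)) : |τ A W e - τ A e B| ≤ 1 - τ e W B := by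
  -- The sign patterns in `h1`, `h2` are opposite, as are those in `h3`, `h4`. Adding a pair kills
  -- the terms of odd degree in A, W, B and leaves twice 1 ∓ τ(A,W,e) ± τ(A,e,B) - τ(e,W,B), one
  -- side of the bound per pair.
  have h1 := hτ _ _ _ hA hW' hB
  have h2 := hτ _ _ _ hA' hW hB'
  have h3 := hτ _ _ _ hA' hW' hB
  have h4 := hτ _ _ _ hA hW hB'
  simp only [map_add, map_sub, AddMonoidHom.add_apply, AddMonoidHom.sub_apply, he]
    at h1 h2 h3 h4
  rw [abs_le]
  constructor <;> linarith

/-- The trilinear form `(X, Y, Z) ↦ Re tr (T (X ⊗ Y ⊗ Z))`. -/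
noncomputable def traceForm₃ (T : DensityOperator (HTensor (HTensor H H) H)) :
    (H →L[ℂ] H) →+ (H →L[ℂ] H) →+ (H →L[ℂ] H) →+ ℝ :=
  AddMonoidHom.mk' (fun X => AddMonoidHom.mk' (fun Y => AddMonoidHom.mk'
    (fun Z => (T.traceL (tensorOp (tensorOp X Y) Z)).re)
    fun Z Z' => by rw [tensorOp_add_right, map_add, Complex.add_re])
    fun Y Y' => AddMonoidHom.ext fun Z =>
      show (T.traceL _).re = (T.traceL _).re + (T.traceL _).re by
        rw [tensorOp_add_right, tensorOp_add_left, map_add, Complex.add_re])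
    fun X X' => AddMonoidHom.ext fun Y => AddMonoidHom.ext fun Z =>
      show (T.traceL _).re = (T.traceL _).re + (T.traceL _).re by
        rw [tensorOp_add_left, tensorOp_add_left, map_add, Complex.add_re]

theorem traceForm₃_apply (T : DensityOperator (HTensor (HTensor H H) H)) (X Y Z : H →L[ℂ] H) :
    traceForm₃ T X Y Z = (T.traceL (tensorOp (tensorOp X Y) Z)).re := rfl

theorem abs_traceL_tensorOp_sub_le (T : DensityOperator (HTensor (HTensor H H) H))
    {A W B : H →L[ℂ] H} (hA : OpBound A 1) (hW : OpBound W 1) (hB : OpBound B 1) :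
    |(T.traceL (tensorOp (tensorOp A W) 1)).re - (T.traceL (tensorOp (tensorOp A 1) B)).re| ≤
      1 - (T.traceL (tensorOp (tensorOp 1 W) B)).re := by
  simp only [OpBound, Complex.ofReal_one, one_smul] at hA hW hB
  refine abs_sub_le_of_trilinear (traceForm₃ T) (P := ContinuousLinearMap.IsPositive)
    (fun X Y Z hX hY hZ => ?_) ?_ hA.1 hA.2 hW.1 hW.2 hB.1 hB.2
  · rw [traceForm₃_apply]
    exact T.traceL_re_nonneg (tensorOp_isPositive (tensorOp_isPositive hX hY) hZ)
  · rw [traceForm₃_apply, tensorOp_one_one, tensorOp_one_one, T.traceL_one, Complex.one_re]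

theorem abs_traceL_tensorOp_sub_le_of_isBellClass {ρ : DensityOperator (HTensor H H)}
    (hρ : IsBellClass ρ) {A W B : H →L[ℂ] H} (hA : OpBound A 1) (hW : OpBound W 1)
    (hB : OpBound B 1) :
    |(ρ.traceL (tensorOp A W)).re - (ρ.traceL (tensorOp A B)).re| ≤
      1 - (ρ.traceL (tensorOp W B)).re := by
  obtain ⟨T, h1, h2, h3⟩ := hρ
  rw [h3.traceL_eq A W, h2.traceL_eq A B, h1.traceL_eq W B]
  exact abs_traceL_tensorOp_sub_le T hA hW hB

end OutcomeLaw

end BellClass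

/-! ### Error count and passage to the limit. -/

open BellClass in
theorem theorem7 {H : Type*} [NormedAddCommGroup H] [InnerProductSpace ℂ H] [CompleteSpace H]
    [TopologicalSpace.SeparableSpace H]
    {Λ₁ Λ₂ : Set ℝ} (hΛ₁ : Λ₁ ⊆ Set.Icc (-1) 1) (hΛ₂ : Λ₂ ⊆ Set.Icc (-1) 1)
    (M₁a M₁b₁ : BellClass.POVM Λ₁ H) (M₂b₁ M₂b₂ : BellClass.POVM Λ₂ H)
    (Mab₁ Mab₂ Mb₁b₂ : BellClass.POVM (Λ₁ × Λ₂) (BellClass.HTensor H H))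
    (hab₁ : BellClass.IsJoint M₁a M₂b₁ Mab₁) (hab₂ : BellClass.IsJoint M₁a M₂b₂ Mab₂)
    (hb₁b₂ : BellClass.IsJoint M₁b₁ M₂b₂ Mb₁b₂)
    (W : H →L[ℂ] H) (hW₁ : M₁b₁.IsAverage W) (hW₂ : M₂b₁.IsAverage W)
    (ρ : BellClass.DensityOperator (BellClass.HTensor H H)) (hρ : BellClass.IsBellClass ρ) :
    |BellClass.productExpectation ρ Mab₁ - BellClass.productExpectation ρ Mab₂| ≤
      1 - BellClass.productExpectation ρ Mb₁b₂ := by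
  -- The 8 is 3 · 2 + 2: each of the three correlations costs 2/n to round, and exchanging the
  -- rounded average of b₁ for W costs 1/n on Bob's side and 1/n on Alice's.
  have key : ∀ n : ℕ, 0 < n →
      |productExpectation ρ Mab₁ - productExpectation ρ Mab₂| ≤
        1 - productExpectation ρ Mb₁b₂ + 8 / n := by
    intro n hn
    have hA := M₁a.opBound_roundedAverage hΛ₁ hn
    have hB := M₂b₂.opBound_roundedAverage hΛ₂ hn
    have b := abs_traceL_tensorOp_sub_le_of_isBellClass hρ hA (hW₁.opBound hΛ₁) hB
    have p₁ := abs_productExpectation_sub_le hΛ₁ hΛ₂ hab₁ ρ hn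
    have p₂ := abs_productExpectation_sub_le hΛ₁ hΛ₂ hab₂ ρ hn
    have p₃ := abs_productExpectation_sub_le hΛ₁ hΛ₂ hb₁b₂ ρ hn
    have w₁ := abs_traceL_tensorOp_le ρ hA (hW₂.opBound_roundedAverage_sub hΛ₂ hn)
    have w₂ := abs_traceL_tensorOp_le ρ (hW₁.opBound_roundedAverage_sub hΛ₁ hn) hB
    simp only [← tensorOpL_apply, map_sub, LinearMap.sub_apply, Complex.sub_re] at b p₁ p₂ p₃ w₁ w₂
    have e₂ : (2 : ℝ) / n = 2 * (1 / n) := by ring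
    have e₈ : (8 : ℝ) / n = 8 * (1 / n) := by ring
    rw [e₂] at p₁ p₂ p₃
    rw [abs_le] at *
    rw [e₈]
    constructor <;> linarith
  have hlim : Filter.Tendsto (fun n : ℕ => 1 - productExpectation ρ Mb₁b₂ + 8 / (n : ℝ))
      Filter.atTop (nhds (1 - productExpectation ρ Mb₁b₂ + 0)) :=
    (tendsto_const_div_atTop_nhds_zero_nat 8).const_add _
  rw [add_zero] at hlim
  exact ge_of_tendsto hlim (Filter.eventually_atTop.mpr ⟨1, fun n hn => key n hn⟩)
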